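/- Theorem 1.1. For $m\ge 1$ and a complex power series $f=\sum_j f_jz^j$, let $B_m(f)$ be the $m\times m$ lower triangular Toeplitz matrix with entries $$B_m(f)_{ab}=f_{m-(a-b)}\ \ (1\le b\le a\le m),\qquad B_m(f)_{ab}=0\ \ (a<b),$$ so that all diagonal entries are $f_m$ and the first column is $(f_m,f_{m-1},\dots,f_1)^T$. Let $n\ge 1$, let $p_1,\dots,p_n$ be real numbers, and let $\lambda$ be Lebesgue measure on $\mathbb C^n\cong\mathbb R^{2n}$. For $x=(x_1,\dots,x_n)\in\mathbb C^n$ and $0\le l<n$ put $$B^{(l)}(x)=B_{n-l}\Big(\sum_{j=1}^{n-l}x_{l+j}z^j\Big).$$ Then the function $x\mapsto\prod_{l=0}^{n-1}\det\big(1+B^{(l)}(x)B^{(l)}(x)^*\big)^{-p_{l+1}}$ is $\lambda$-integrable on $\mathbb C^n$ if and only if $$kp_1+(k-1)p_2+\cdots+p_k>2k-1\qquad\text{for every }1\le k\le n,$$ and in that case $$\int_{\mathbb C^n}\prod_{l=0}^{n-1}\det\big(1+B^{(l)}(x)B^{(l)}(x)^*\big)^{-p_{l+1}}\,d\lambda(x_1,\dots,x_n)=\pi^n\prod_{k=1}^n\frac1{kp_1+(k-1)p_2+\cdots+p_k-(2k-1)}.$$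 In particular, for real $p$ and $B_n(x)=B_n\big(\sum_{j=1}^nx_jz^j\big)$, the measure $$\frac1{\det(1+B_n(x)B_n(x)^*)^p}\,d\lambda(x_1,\dots,x_n)$$ on $\mathbb C^n$ is finite if and only if $p>2-1/n$. -/

import Mathlib

open MeasureTheory
open scoped Matrix ComplexOrder

noncomputable section

/-- The `m × m` lower triangular Toeplitz matrix `B_m(f)` of a power series `f = ∑ f_j z^j`.
With rows and columns numbered from `0`, the entry in row `a` and column `b` is the coefficient
`f_{m - (a - b)}` if `b ≤ a`, and `0` if `b > a`; so the diagonal is `f_m` and the first column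
is `f_m, f_{m-1}, …, f_1`. -/
def toeplitzB (m : ℕ) (f : PowerSeries ℂ) : Matrix (Fin m) (Fin m) ℂ :=
  Matrix.of fun a b => if b ≤ a then PowerSeries.coeff (m - ((a : ℕ) - (b : ℕ))) f else 0

/-- The polynomial `∑_{j=1}^{n-l} x_{l+j} z^j`. The vector `(x_1, …, x_n)` is a function on
`Fin n`, with `x_k` stored at position `k - 1`; the summation index below is `j - 1`. -/
def shiftedSeries {n : ℕ} (l : ℕ) (x : Fin n → ℂ) : PowerSeries ℂ :=
  ∑ j : Fin (n - l), PowerSeries.monomial ((j : ℕ) + 1) (x ⟨l + (j : ℕ), by omega⟩)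

/-- The number `det (1 + B_m(f) B_m(f)^*)`, which is real and positive
(see `toeplitzDet_pos` and `ofReal_toeplitzDet`). -/
def toeplitzDet (m : ℕ) (f : PowerSeries ℂ) : ℝ :=
  ((1 + toeplitzB m f * (toeplitzB m f)ᴴ).det).re

theorem toeplitz_det_pos_aux (m : ℕ) (f : PowerSeries ℂ) :
    0 < (1 + toeplitzB m f * (toeplitzB m f)ᴴ).det :=
  (Matrix.PosDef.one.add_posSemidef
    (Matrix.posSemidef_self_mul_conjTranspose (toeplitzB m f))).det_pos

theorem toeplitzDet_pos (m : ℕ) (f : PowerSeries ℂ) : 0 < toeplitzDet m f :=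
  (Complex.pos_iff.mp (toeplitz_det_pos_aux m f)).1

theorem ofReal_toeplitzDet (m : ℕ) (f : PowerSeries ℂ) :
    (toeplitzDet m f : ℂ) = (1 + toeplitzB m f * (toeplitzB m f)ᴴ).det :=
  Complex.ext rfl (Complex.pos_iff.mp (toeplitz_det_pos_aux m f)).2

end

/-! Read backwards from the last variable, the matrices `B⁽ˡ⁾` are nested sections of one lower
triangular Toeplitz matrix. Let `D_k` be the determinant of `1 + T Tᴴ` for its section `T` of size
`k`. Only `D_n` contains `x₁`, as the corner entry, and a Desnanot–Jacobi identity
(`exists_gram_lowerToeplitz_corner`) gives `D_n D_{n-2} = D_{n-1}² + D_{n-2}² |x₁ - g|²` with `g`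
independent of `x₁`. The integral over `x₁` is thus the planar integral of `(a |w - g|² + b) ^
(-p₁)`. It diverges for `p₁ ≤ 1`; otherwise it is `π / (p₁ - 1)` times a monomial in `D_{n-1}` and
`D_{n-2}`. What remains is the same integral in one variable fewer with new exponents, whose
weighted sums are the old ones shifted by one index and lowered by 2
(`weightedSum_reducedExponent`). Induction and Tonelli give convergence and value together. -/

/-! ### Gram determinants of bordered matrices -/

open Matrix in
theorem Matrix.isUnit_one_add_mul_conjTranspose {ι κ : Type*} [Fintype ι] [DecidableEq ι] [Fintype κ]
    (A : Matrix ι κ ℂ) : IsUnit (1 + A * Aᴴ) :=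
  (PosDef.one.add_posSemidef (posSemidef_self_mul_conjTranspose A)).isUnit

open Matrix in
theorem Matrix.isUnit_one_add_conjTranspose_mul {ι κ : Type*} [Fintype ι] [DecidableEq ι] [Fintype κ]
    (A : Matrix κ ι ℂ) : IsUnit (1 + Aᴴ * A) :=
  (PosDef.one.add_posSemidef (posSemidef_conjTranspose_mul_self A)).isUnit

open Matrix in
theorem Matrix.inv_one_add_conjTranspose_mul {ι κ : Type*} [Fintype ι] [DecidableEq ι] [Fintype κ]
    [DecidableEq κ] (A : Matrix κ ι ℂ) : (1 + Aᴴ * A)⁻¹ = 1 - Aᴴ * (1 + A * Aᴴ)⁻¹ * A := by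
  have hR : (1 + A * Aᴴ) * (1 + A * Aᴴ)⁻¹ = 1 :=
    mul_nonsing_inv _ ((isUnit_iff_isUnit_det _).1 (isUnit_one_add_mul_conjTranspose A))
  apply inv_eq_right_inv
  have h2 : (1 + Aᴴ * A) * (1 - Aᴴ * (1 + A * Aᴴ)⁻¹ * A) =
      1 + Aᴴ * A - Aᴴ * ((1 + A * Aᴴ) * (1 + A * Aᴴ)⁻¹) * A := by
    simp only [Matrix.mul_add, Matrix.add_mul, Matrix.mul_sub, Matrix.one_mul, Matrix.mul_one, Matrix.mul_assoc]
  rw [h2, hR]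
  simp

open Matrix in
theorem Matrix.det_fromBlocks_of_isUnit {ι κ : Type*} [Fintype ι] [DecidableEq ι] [Fintype κ]
    [DecidableEq κ] {A : Matrix ι ι ℂ} (hA : IsUnit A) (B : Matrix ι κ ℂ) (C : Matrix κ ι ℂ)
    (D : Matrix κ κ ℂ) : (fromBlocks A B C D).det = A.det * (D - C * A⁻¹ * B).det := by
  have := hA.invertible
  rw [det_fromBlocks₁₁, invOf_eq_nonsing_inv]

open Matrix in
/-- The Gram determinant of a block lower triangular matrix as a bordered determinant. -/
theorem Matrix.det_one_add_fromBlocks_mul_conjTranspose {ι κ : Type*} [Fintype ι] [DecidableEq ι]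
    [Fintype κ] [DecidableEq κ] (P : Matrix ι ι ℂ) (q : Matrix κ ι ℂ) (d : Matrix κ κ ℂ) :
    (1 + fromBlocks P 0 q d * (fromBlocks P 0 q d)ᴴ).det =
      (fromBlocks (1 + Pᴴ * P) qᴴ (-q) (1 + d * dᴴ)).det := by
  rw [det_fromBlocks_of_isUnit (isUnit_one_add_conjTranspose_mul P), fromBlocks_conjTranspose,
    fromBlocks_multiply, ← fromBlocks_one, fromBlocks_add, conjTranspose_zero, Matrix.zero_mul,
    Matrix.mul_zero, Matrix.zero_mul, add_zero, add_zero, add_zero, zero_add, zero_add,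
    det_fromBlocks_of_isUnit (isUnit_one_add_mul_conjTranspose P), det_one_add_mul_comm P Pᴴ,
    inv_one_add_conjTranspose_mul]
  congr 2
  simp only [Matrix.mul_sub, Matrix.sub_mul, Matrix.mul_one, Matrix.mul_assoc, Matrix.neg_mul]
  abel

open Matrix in
theorem Matrix.det_unit_sum_unit (M : Matrix (Unit ⊕ Unit) (Unit ⊕ Unit) ℂ) :
    M.det = M (.inl ()) (.inl ()) * M (.inr ()) (.inr ()) -
      M (.inl ()) (.inr ()) * M (.inr ()) (.inl ()) := by
  rw [← det_submatrix_equiv_self (finTwoEquiv.trans Equiv.boolEquivPUnitSumPUnit), det_fin_two]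
  rfl

open Matrix in
/-- The Gram determinant of a doubly bordered matrix is a quadratic function of its corner `w`. -/
theorem Matrix.exists_det_one_add_corner {ι : Type*} [Fintype ι] [DecidableEq ι]
    (A : Matrix ι ι ℂ) (u : Matrix ι Unit ℂ) (v : Matrix Unit ι ℂ) (d d' : Matrix Unit Unit ℂ) :
    ∃ g : ℂ, ∀ w : ℂ,
      (1 + fromBlocks (fromBlocks A u 0 d) 0 (fromCols v (of fun _ _ => w)) d' *
        (fromBlocks (fromBlocks A u 0 d) 0 (fromCols v (of fun _ _ => w)) d')ᴴ).det *
        (1 + A * Aᴴ).det =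
      (1 + fromBlocks A u 0 d * (fromBlocks A u 0 d)ᴴ).det *
        (1 + fromBlocks A 0 v d' * (fromBlocks A 0 v d')ᴴ).det +
        (1 + A * Aᴴ).det ^ 2 * ((w - g) * star (w - g)) := by
  set K := 1 + Aᴴ * A with hK
  have hKu : IsUnit K := isUnit_one_add_conjTranspose_mul A
  -- The Schur complement of `K` in the doubly bordered matrix is `2 × 2`. Its diagonal comes from
  -- the two singly bordered matrices; its off-diagonal entries are `star (w - g)` and `-(w - g)`
  -- for this `g`.
  refine ⟨(v * K⁻¹ * (Aᴴ * u)) () (), fun w => ?_⟩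
  set W : Matrix Unit Unit ℂ := of fun _ _ => w with hW
  have hP : 1 + (fromBlocks A u 0 d)ᴴ * fromBlocks A u 0 d =
      fromBlocks K (Aᴴ * u) (uᴴ * A) (1 + (uᴴ * u + dᴴ * d)) := by
    rw [fromBlocks_conjTranspose, fromBlocks_multiply, ← fromBlocks_one, fromBlocks_add]
    simp [hK]
  have hX : (fromBlocks (fromBlocks K (Aᴴ * u) (uᴴ * A) (1 + (uᴴ * u + dᴴ * d)))
      (fromCols v W)ᴴ (-(fromCols v W)) (1 + d' * d'ᴴ)).det =
      (fromBlocks K (fromCols (Aᴴ * u) vᴴ) (fromRows (uᴴ * A) (-v))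
        (fromBlocks (1 + (uᴴ * u + dᴴ * d)) Wᴴ (-W) (1 + d' * d'ᴴ))).det := by
    rw [← det_submatrix_equiv_self (Equiv.sumAssoc ι Unit Unit)]
    congr 1
    ext ((i | i) | i) ((j | j) | j) <;> rfl
  rw [det_one_add_fromBlocks_mul_conjTranspose, det_one_add_fromBlocks_mul_conjTranspose,
    det_one_add_mul_comm (fromBlocks A u 0 d), hP, hX, det_one_add_mul_comm A, ← hK,
    det_fromBlocks_of_isUnit hKu, det_fromBlocks_of_isUnit hKu, det_fromBlocks_of_isUnit hKu,
    det_unit_sum_unit, det_unique (n := Unit), det_unique (n := Unit), fromRows_mul, fromRows_mul_fromCols]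
  have hstar : star ((v * K⁻¹ * (Aᴴ * u)) () ()) = (uᴴ * A * K⁻¹ * vᴴ) () () := by
    rw [← conjTranspose_apply]
    have : K⁻¹ᴴ = K⁻¹ := by rw [conjTranspose_nonsing_inv]; congr 1; simp [hK]
    rw [conjTranspose_mul, conjTranspose_mul, conjTranspose_mul, this,
      conjTranspose_conjTranspose, Matrix.mul_assoc (uᴴ * A)]
  rw [star_sub, hstar]
  simp only [Matrix.sub_apply, fromBlocks_apply₁₁, fromBlocks_apply₁₂, fromBlocks_apply₂₁,
    fromBlocks_apply₂₂, Matrix.neg_mul, Matrix.neg_apply, conjTranspose_apply, hW, of_apply,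
    PUnit.default_eq_unit]
  ring

/-! ### The planar integral of a power of a quadratic -/

theorem lintegral_Ioi_mul_rpow {a b p : ℝ} (ha : 0 < a) (hb : 0 < b) (hp : 1 < p) :
    ∫⁻ r in Set.Ioi (0 : ℝ), ENNReal.ofReal (r * (a * r ^ 2 + b) ^ (-p)) =
      ENNReal.ofReal (b ^ (1 - p) / (2 * a * (p - 1))) := by
  have hpos : ∀ r : ℝ, 0 < a * r ^ 2 + b := fun r => by positivity
  have hp' : 0 < p - 1 := by linarith
  have hderiv : ∀ r ∈ Set.Ici (0 : ℝ),
      HasDerivAt (fun r => -(a * r ^ 2 + b) ^ (1 - p) / (2 * a * (p - 1)))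
        (r * (a * r ^ 2 + b) ^ (-p)) r := fun r _ => by
    have h1 : HasDerivAt (fun r : ℝ => a * r ^ 2 + b) (a * (2 * r)) r := by
      simpa using ((hasDerivAt_pow 2 r).const_mul a).add_const b
    have h2 := ((h1.rpow_const (p := 1 - p) (Or.inl (hpos r).ne')).neg).div_const (2 * a * (p - 1))
    refine h2.congr_deriv ?_
    rw [show 1 - p - 1 = -p by ring]
    field_simp
    ring
  have hnn : ∀ r ∈ Set.Ioi (0 : ℝ), 0 ≤ r * (a * r ^ 2 + b) ^ (-p) := fun r hr =>
    mul_nonneg (le_of_lt hr) (Real.rpow_nonneg (hpos r).le _)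
  have hlim : Filter.Tendsto (fun r => -(a * r ^ 2 + b) ^ (1 - p) / (2 * a * (p - 1)))
      Filter.atTop (nhds 0) := by
    have h1 : Filter.Tendsto (fun r : ℝ => a * r ^ 2 + b) Filter.atTop Filter.atTop :=
      Filter.tendsto_atTop_add_const_right _ _
        ((Filter.tendsto_pow_atTop two_ne_zero).const_mul_atTop ha)
    have h2 := ((tendsto_rpow_neg_atTop hp').comp h1).neg.div_const (2 * a * (p - 1))
    simpa [Function.comp_def] using h2
  rw [← ofReal_integral_eq_lintegral_ofReal (integrableOn_Ioi_deriv_of_nonneg' hderiv hnn hlim)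
    ((ae_restrict_iff' measurableSet_Ioi).2 (.of_forall hnn)),
    integral_Ioi_of_hasDerivAt_of_nonneg' hderiv hnn hlim]
  congr 1
  simp [neg_div]

theorem lintegral_quadratic_rpow_of_one_lt {a b p : ℝ} (ha : 0 < a) (hb : 0 < b) (hp : 1 < p)
    (g : ℂ) :
    ∫⁻ y : ℂ, ENNReal.ofReal ((a * ‖y - g‖ ^ 2 + b) ^ (-p)) =
      ENNReal.ofReal (Real.pi / (p - 1) * (a⁻¹ * b ^ (1 - p))) := by
  rw [lintegral_sub_right_eq_self (fun y : ℂ => ENNReal.ofReal ((a * ‖y‖ ^ 2 + b) ^ (-p))) g,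
    ← Complex.lintegral_comp_polarCoord_symm, polarCoord_target, Measure.volume_eq_prod,
    ← Measure.prod_restrict]
  have hcongr : ∀ z : ℝ × ℝ, ENNReal.ofReal z.1 •
      ENNReal.ofReal ((a * ‖Complex.polarCoord.symm z‖ ^ 2 + b) ^ (-p)) =
      ENNReal.ofReal (z.1 * (a * z.1 ^ 2 + b) ^ (-p)) * 1 := fun z => by
    rw [Complex.norm_polarCoord_symm, sq_abs, smul_eq_mul, mul_one,
      ENNReal.ofReal_mul' (Real.rpow_nonneg (by positivity) _)]
  simp_rw [hcongr]
  rw [lintegral_prod_mul (f := fun r : ℝ => ENNReal.ofReal (r * (a * r ^ 2 + b) ^ (-p)))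
    (g := fun _ => 1) (by fun_prop) (by fun_prop), lintegral_Ioi_mul_rpow ha hb hp]
  have hp' : p - 1 ≠ 0 := by linarith
  rw [lintegral_one, Measure.restrict_apply_univ, Real.volume_Ioo,
    ← ENNReal.ofReal_mul' (by linarith [Real.pi_pos])]
  congr 1
  field_simp
  ring

/-- The base is at least `b`, so for `q > 1` the integrand dominates `b ^ (q - p)` times its
analogue with exponent `-q`, whose integral blows up as `q` decreases to 1. -/
theorem lintegral_quadratic_rpow_of_le_one {a b p : ℝ} (ha : 0 < a) (hb : 0 < b) (hp : p ≤ 1)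
    (g : ℂ) :
    ∫⁻ y : ℂ, ENNReal.ofReal ((a * ‖y - g‖ ^ 2 + b) ^ (-p)) = ⊤ := by
  have hle : ∀ q : ℝ, 1 < q → ENNReal.ofReal (Real.pi / (q - 1) * (a⁻¹ * b ^ (1 - p))) ≤
      ∫⁻ y : ℂ, ENNReal.ofReal ((a * ‖y - g‖ ^ 2 + b) ^ (-p)) := fun q hq => by
    have h := congrArg (ENNReal.ofReal (b ^ (q - p)) * ·)
      (lintegral_quadratic_rpow_of_one_lt ha hb hq g)
    rw [← lintegral_const_mul' _ _ ENNReal.ofReal_ne_top, ← ENNReal.ofReal_mul (by positivity),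
      show b ^ (q - p) * (Real.pi / (q - 1) * (a⁻¹ * b ^ (1 - q))) =
        Real.pi / (q - 1) * (a⁻¹ * (b ^ (q - p) * b ^ (1 - q))) by ring, ← Real.rpow_add hb,
      show q - p + (1 - q) = 1 - p by ring] at h
    rw [← h]
    refine lintegral_mono fun y => ?_
    rw [← ENNReal.ofReal_mul (by positivity)]
    refine ENNReal.ofReal_le_ofReal ?_
    have hs : b ≤ a * ‖y - g‖ ^ 2 + b := le_add_of_nonneg_left (by positivity)
    calc b ^ (q - p) * (a * ‖y - g‖ ^ 2 + b) ^ (-q)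
        ≤ (a * ‖y - g‖ ^ 2 + b) ^ (q - p) * (a * ‖y - g‖ ^ 2 + b) ^ (-q) := by
          gcongr
          linarith
      _ = (a * ‖y - g‖ ^ 2 + b) ^ (-p) := by
          rw [← Real.rpow_add (by positivity)]
          congr 1
          ring
  refine ENNReal.eq_top_of_forall_nnreal_le fun r => ?_
  set C := Real.pi * (a⁻¹ * b ^ (1 - p)) with hC
  have hCpos : 0 < C := by positivity
  have hr : (0 : ℝ) < r + 1 := by positivity
  -- This `q` makes the lower bound `C / (q - 1)` equal to `r + 1`.
  refine le_trans ?_ (hle (1 + C / (r + 1)) (by linarith [div_pos hCpos hr]))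
  rw [show Real.pi / (1 + C / (r + 1) - 1) * (a⁻¹ * b ^ (1 - p)) = C / (C / (r + 1)) by
    rw [hC]; ring, div_div_cancel₀ hCpos.ne', ← ENNReal.ofReal_coe_nnreal]
  exact ENNReal.ofReal_le_ofReal (by linarith)

/-! ### Nested Toeplitz sections and their corner recursion -/

/-- The lower triangular Toeplitz matrix whose first column is `y 0, …, y (m - 1)`. -/
def lowerToeplitz (m : ℕ) (y : ℕ → ℂ) : Matrix (Fin m) (Fin m) ℂ :=
  Matrix.of fun a b => if b ≤ a then y ((a : ℕ) - (b : ℕ)) else 0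

/-- The entries of `x` in reverse order, extended by zero. -/
def reverseExtend {n : ℕ} (x : Fin n → ℂ) (k : ℕ) : ℂ :=
  if h : k < n then x ⟨n - 1 - k, by omega⟩ else 0

theorem lowerToeplitz_congr {m : ℕ} {y y' : ℕ → ℂ} (h : ∀ k < m, y k = y' k) :
    lowerToeplitz m y = lowerToeplitz m y' := by
  ext a b
  simp only [lowerToeplitz, Matrix.of_apply]
  split_ifs
  · exact h _ (by omega)
  · rfl

theorem coeff_shiftedSeries {n : ℕ} (l : ℕ) (x : Fin n → ℂ) (j : ℕ) (hj : j < n - l) :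
    PowerSeries.coeff (j + 1) (shiftedSeries l x) = x ⟨l + j, by omega⟩ := by
  simp only [shiftedSeries, map_sum, PowerSeries.coeff_monomial, add_left_inj]
  rw [Finset.sum_eq_single ⟨j, hj⟩]
  · simp
  · intro b _ hb
    rw [if_neg]
    rintro rfl
    exact hb rfl
  · simp

/-- The first column of `B⁽ˡ⁾` is `x_n, x_{n-1}, …, x_{l+1}`, so in reversed order `l` affects only
the size. -/
theorem toeplitzB_shiftedSeries {n : ℕ} (l : ℕ) (x : Fin n → ℂ) :
    toeplitzB (n - l) (shiftedSeries l x) = lowerToeplitz (n - l) (reverseExtend x) := by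
  ext a b
  simp only [toeplitzB, lowerToeplitz, Matrix.of_apply]
  split_ifs with h
  · have ha := a.2
    have hb : (b : ℕ) ≤ a := h
    rw [show n - l - ((a : ℕ) - b) = (n - l - 1 - (a - b)) + 1 by omega,
      coeff_shiftedSeries l x _ (by omega), reverseExtend, dif_pos (by omega)]
    congr 2
    omega
  · rfl

theorem reverseExtend_cons {n : ℕ} (w : ℂ) (x : Fin n → ℂ) {k : ℕ} (hk : k < n) :
    reverseExtend (Fin.cons w x : Fin (n + 1) → ℂ) k = reverseExtend x k := by
  rw [reverseExtend, reverseExtend, dif_pos (by omega), dif_pos hk]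
  have : (⟨n + 1 - 1 - k, by omega⟩ : Fin (n + 1)) = Fin.succ ⟨n - 1 - k, by omega⟩ := by
    ext
    simp only [Fin.val_succ]
    omega
  rw [this, Fin.cons_succ]

theorem reverseExtend_cons_self {n : ℕ} (w : ℂ) (x : Fin n → ℂ) :
    reverseExtend (Fin.cons w x : Fin (n + 1) → ℂ) n = w := by
  simp [reverseExtend]

theorem toeplitzDet_shiftedSeries_succ_cons {n : ℕ} (l : ℕ) (w : ℂ) (x : Fin n → ℂ) :
    toeplitzDet (n + 1 - (l + 1)) (shiftedSeries (l + 1) (Fin.cons w x : Fin (n + 1) → ℂ)) =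
      toeplitzDet (n - l) (shiftedSeries l x) := by
  unfold toeplitzDet
  rw [toeplitzB_shiftedSeries, toeplitzB_shiftedSeries,
    lowerToeplitz_congr (y' := reverseExtend x) fun k hk => reverseExtend_cons w x (by omega),
    Nat.add_sub_add_right]

theorem continuous_toeplitzDet_shiftedSeries {n : ℕ} (l : ℕ) :
    Continuous fun x : Fin n → ℂ => toeplitzDet (n - l) (shiftedSeries l x) := by
  unfold toeplitzDet
  simp_rw [toeplitzB_shiftedSeries]
  have h : Continuous fun x : Fin n → ℂ => lowerToeplitz (n - l) (reverseExtend x) := by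
    refine continuous_matrix fun a b => ?_
    simp only [lowerToeplitz, Matrix.of_apply, reverseExtend]
    split_ifs <;> fun_prop
  exact Complex.continuous_re.comp
    (continuous_const.add (h.matrix_mul h.matrix_conjTranspose)).matrix_det

open Matrix in
theorem Matrix.det_one_add_submatrix_mul_conjTranspose {ι κ : Type*} [Fintype ι] [DecidableEq ι]
    [Fintype κ] [DecidableEq κ] (e : κ ≃ ι) (M : Matrix ι ι ℂ) :
    (1 + M.submatrix e e * (M.submatrix e e)ᴴ).det = (1 + M * Mᴴ).det := by
  rw [conjTranspose_submatrix, submatrix_mul_equiv, ← submatrix_one_equiv e,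
    ← Pi.add_apply, ← Pi.add_apply, ← submatrix_add, det_submatrix_equiv_self]

/-- `Fin (m + 1)` as `Fin m` with a first element added. -/
def sumUnitEquivFinSucc (m : ℕ) : Fin m ⊕ Unit ≃ Fin (m + 1) :=
  (Equiv.optionEquivSumPUnit (Fin m)).symm.trans (finSuccEquiv m).symm

/-- `Fin (m + 1)` as `Fin m` with a last element added. -/
def sumUnitEquivFinSuccLast (m : ℕ) : Fin m ⊕ Unit ≃ Fin (m + 1) :=
  (Equiv.optionEquivSumPUnit (Fin m)).symm.trans finSuccEquivLast.symm

@[simp] theorem sumUnitEquivFinSucc_inl (m : ℕ) (i : Fin m) :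
    sumUnitEquivFinSucc m (.inl i) = i.succ := by simp [sumUnitEquivFinSucc]

@[simp] theorem sumUnitEquivFinSucc_inr (m : ℕ) (i : Unit) :
    sumUnitEquivFinSucc m (.inr i) = 0 := by simp [sumUnitEquivFinSucc]

@[simp] theorem sumUnitEquivFinSuccLast_inl (m : ℕ) (i : Fin m) :
    sumUnitEquivFinSuccLast m (.inl i) = i.castSucc := by simp [sumUnitEquivFinSuccLast]

@[simp] theorem sumUnitEquivFinSuccLast_inr (m : ℕ) (i : Unit) :
    sumUnitEquivFinSuccLast m (.inr i) = Fin.last m := by simp [sumUnitEquivFinSuccLast]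

open Matrix in
theorem lowerToeplitz_submatrix_first (m : ℕ) (y : ℕ → ℂ) :
    (lowerToeplitz (m + 1) y).submatrix (sumUnitEquivFinSucc m) (sumUnitEquivFinSucc m) =
      fromBlocks (lowerToeplitz m y) (of fun i _ => y (i + 1)) 0 (of fun _ _ => y 0) := by
  ext (i | i) (j | j) <;> simp [lowerToeplitz]

open Matrix in
theorem lowerToeplitz_submatrix_last (m : ℕ) (y : ℕ → ℂ) :
    (lowerToeplitz (m + 1) y).submatrix (sumUnitEquivFinSuccLast m) (sumUnitEquivFinSuccLast m) =
      fromBlocks (lowerToeplitz m y) 0 (of fun _ j => y (m - j)) (of fun _ _ => y 0) := by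
  ext (i | i) (j | j) <;> simp [lowerToeplitz, Fin.le_last]

open Matrix in
theorem lowerToeplitz_submatrix_corner (m : ℕ) (y : ℕ → ℂ) :
    (lowerToeplitz (m + 2) y).submatrix
      (((sumUnitEquivFinSucc m).sumCongr (Equiv.refl Unit)).trans (sumUnitEquivFinSuccLast (m + 1)))
      (((sumUnitEquivFinSucc m).sumCongr (Equiv.refl Unit)).trans (sumUnitEquivFinSuccLast (m + 1)))
      = fromBlocks
        (fromBlocks (lowerToeplitz m y) (of fun i _ => y (i + 1)) 0 (of fun _ _ => y 0)) 0
        (fromCols (of fun _ j => y (m - j)) (of fun _ _ => y (m + 1))) (of fun _ _ => y 0) := by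
  ext ((i | i) | i) ((j | j) | j) <;> simp [lowerToeplitz, Fin.le_last]

open Matrix in
/-- A Desnanot–Jacobi identity: the Gram determinant of a Toeplitz matrix as a function of its
corner entry. -/
theorem exists_gram_lowerToeplitz_corner (m : ℕ) (y : ℕ → ℂ) : ∃ g : ℂ, ∀ y' : ℕ → ℂ,
    (∀ k < m + 1, y' k = y k) →
    (1 + lowerToeplitz (m + 2) y' * (lowerToeplitz (m + 2) y')ᴴ).det *
        (1 + lowerToeplitz m y * (lowerToeplitz m y)ᴴ).det =
      (1 + lowerToeplitz (m + 1) y * (lowerToeplitz (m + 1) y)ᴴ).det ^ 2 +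
        (1 + lowerToeplitz m y * (lowerToeplitz m y)ᴴ).det ^ 2 *
          ((y' (m + 1) - g) * star (y' (m + 1) - g)) := by
  obtain ⟨g, hg⟩ := exists_det_one_add_corner (lowerToeplitz m y) (of fun i _ => y (i + 1))
    (of fun _ j => y (m - j)) (of fun _ _ => y 0) (of fun _ _ => y 0)
  refine ⟨g, fun y' hy' => ?_⟩
  have h := hg (y' (m + 1))
  -- Both singly bordered matrices are the Toeplitz matrix of size `m + 1`, hence the square.
  rw [← lowerToeplitz_submatrix_first, ← lowerToeplitz_submatrix_last,
    det_one_add_submatrix_mul_conjTranspose, det_one_add_submatrix_mul_conjTranspose,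
    ← pow_two] at h
  rw [← h, ← det_one_add_submatrix_mul_conjTranspose
    (((sumUnitEquivFinSucc m).sumCongr (Equiv.refl Unit)).trans (sumUnitEquivFinSuccLast (m + 1)))
    (lowerToeplitz (m + 2) y'), lowerToeplitz_submatrix_corner, lowerToeplitz_submatrix_first,
    lowerToeplitz_congr (y := y') (y' := y) fun k hk => hy' k (by omega)]
  have h1 : (of fun (i : Fin m) (_ : Unit) => y' (i + 1)) = of fun (i : Fin m) _ => y (i + 1) := by
    ext i
    exact hy' _ (by omega)
  have h2 : (of fun (_ : Unit) (j : Fin m) => y' (m - j)) = of fun _ (j : Fin m) => y (m - j) := by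
    ext i j
    exact hy' _ (by omega)
  rw [h1, h2, hy' 0 (by omega)]

theorem exists_toeplitzDet_cons {n : ℕ} (x : Fin n → ℂ) : ∃ g : ℂ, ∀ w : ℂ,
    toeplitzDet (n + 1) (shiftedSeries 0 (Fin.cons w x : Fin (n + 1) → ℂ)) =
      toeplitzDet (n - 1) (shiftedSeries 1 x) * ‖w - g‖ ^ 2 +
        toeplitzDet n (shiftedSeries 0 x) ^ 2 / toeplitzDet (n - 1) (shiftedSeries 1 x) := by
  obtain _ | m := n
  -- With `n = 0` the truncated `n - 1` is 0, both determinants on the right are empty, and the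
  -- claim is `1 + |w|²`.
  · refine ⟨0, fun w => ?_⟩
    have h := toeplitzB_shiftedSeries 0 (Fin.cons w x : Fin 1 → ℂ)
    simp only [toeplitzDet, Nat.sub_zero] at h ⊢
    rw [h]
    simp [lowerToeplitz, reverseExtend, Matrix.mul_apply, ← Complex.normSq_eq_norm_sq, Complex.normSq_apply]
    ring
  · obtain ⟨g, hg⟩ := exists_gram_lowerToeplitz_corner m (reverseExtend x)
    refine ⟨g, fun w => ?_⟩
    have h := hg (reverseExtend (Fin.cons w x : Fin (m + 2) → ℂ)) fun k hk =>
      reverseExtend_cons w x hk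
    have h0 := toeplitzB_shiftedSeries 0 (Fin.cons w x : Fin (m + 2) → ℂ)
    have h1 := toeplitzB_shiftedSeries 0 x
    have h2 : toeplitzB m (shiftedSeries 1 x) = lowerToeplitz m (reverseExtend x) :=
      toeplitzB_shiftedSeries 1 x
    simp only [Nat.sub_zero, Nat.add_sub_cancel] at h0 h1 ⊢
    rw [← h0, ← h1, ← h2, reverseExtend_cons_self, ← ofReal_toeplitzDet, ← ofReal_toeplitzDet,
      ← ofReal_toeplitzDet, Complex.star_def, Complex.mul_conj, Complex.normSq_eq_norm_sq] at h
    have h' := toeplitzDet_pos m (shiftedSeries 1 x)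
    norm_cast at h
    field_simp
    linarith

/-! ### Bookkeeping of the exponents -/

/-- The sum `k p₁ + (k - 1) p₂ + ⋯ + p_k`. -/
def weightedSum (p : ℕ → ℝ) (k : ℕ) : ℝ :=
  ∑ i ∈ Finset.Icc 1 k, ((k : ℝ) - (i : ℝ) + 1) * p i

/-- The exponents that are left after the first variable has been integrated out. -/
def reducedExponent (p : ℕ → ℝ) (i : ℕ) : ℝ :=
  p (i + 1) + (if i = 1 then 2 * p 1 - 2 else 0) + (if i = 2 then 2 - p 1 else 0)

/-- The product `∏ l, det (1 + B⁽ˡ⁾(x) B⁽ˡ⁾(x)ᴴ) ^ (-p (l + 1))`. -/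
noncomputable def toeplitzDensity (n : ℕ) (p : ℕ → ℝ) (x : Fin n → ℂ) : ℝ :=
  ∏ l ∈ Finset.range n, toeplitzDet (n - l) (shiftedSeries l x) ^ (-(p (l + 1)))

@[to_additive]
theorem Finset.prod_Icc_eq_prod_range {M : Type*} [CommMonoid M] (f : ℕ → M) (k : ℕ) :
    ∏ i ∈ Finset.Icc 1 k, f i = ∏ i ∈ Finset.range k, f (i + 1) := by
  rw [Finset.range_eq_Ico, Finset.prod_Ico_add']
  rfl

theorem weightedSum_one (p : ℕ → ℝ) : weightedSum p 1 = p 1 := by simp [weightedSum]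

/-- The two corrections contribute `k (2 p₁ - 2) + (k - 1) (2 - p₁) = (k + 1) p₁ - 2`. -/
theorem weightedSum_reducedExponent (p : ℕ → ℝ) {k : ℕ} (hk : 1 ≤ k) :
    weightedSum (reducedExponent p) k = weightedSum p (k + 1) - 2 := by
  have h1 : weightedSum p (k + 1) =
      (∑ i ∈ Finset.Icc 1 k, ((k : ℝ) - (i : ℝ) + 1) * p (i + 1)) + ((k : ℝ) + 1) * p 1 := by
    rw [weightedSum, Finset.sum_Icc_eq_sum_range, Finset.sum_range_succ',
      Finset.sum_Icc_eq_sum_range]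
    congr 1
    · refine Finset.sum_congr rfl fun i _ => ?_
      push_cast
      ring
    · push_cast
      ring
  have h2 : (if 2 ≤ k then ((k : ℝ) - 2 + 1) * (2 - p 1) else 0) = ((k : ℝ) - 1) * (2 - p 1) := by
    split_ifs with h
    · ring
    · obtain rfl : k = 1 := by omega
      simp
  simp only [weightedSum, reducedExponent] at h1 ⊢
  simp only [mul_add, Finset.sum_add_distrib, mul_ite, mul_zero, Finset.sum_ite_eq',
    Finset.mem_Icc, le_refl, hk, true_and, if_true, one_le_two, Nat.cast_one, Nat.cast_ofNat] at h1 ⊢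
  rw [h1, h2]
  ring

theorem toeplitzDensity_pos {n : ℕ} (p : ℕ → ℝ) (x : Fin n → ℂ) : 0 < toeplitzDensity n p x :=
  Finset.prod_pos fun _ _ => Real.rpow_pos_of_pos (toeplitzDet_pos _ _) _

theorem continuous_toeplitzDensity (n : ℕ) (p : ℕ → ℝ) : Continuous (toeplitzDensity n p) :=
  continuous_finsetProd _ fun l _ => (continuous_toeplitzDet_shiftedSeries l).rpow_const
    fun _ => Or.inl (toeplitzDet_pos _ _).ne'

theorem toeplitzDensity_cons {n : ℕ} (p : ℕ → ℝ) (w : ℂ) (x : Fin n → ℂ) :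
    toeplitzDensity (n + 1) p (Fin.cons w x : Fin (n + 1) → ℂ) =
      toeplitzDensity n (fun i => p (i + 1)) x *
        toeplitzDet (n + 1) (shiftedSeries 0 (Fin.cons w x : Fin (n + 1) → ℂ)) ^ (-p 1) := by
  rw [toeplitzDensity, Finset.prod_range_succ', toeplitzDensity]
  congr 1
  refine Finset.prod_congr rfl fun l _ => ?_
  rw [toeplitzDet_shiftedSeries_succ_cons]

theorem toeplitzDet_zero (f : PowerSeries ℂ) : toeplitzDet 0 f = 1 := by simp [toeplitzDet]

/-- With `a = D_{n-1}` and `b = D_n² / D_{n-1}`, the factor `a⁻¹ b ^ (1 - p₁)` equals `D_n ^ (2 - 2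
p₁) D_{n-1} ^ (p₁ - 2)`, which changes only the first two exponents. -/
theorem toeplitzDensity_reducedExponent {n : ℕ} (p : ℕ → ℝ) (x : Fin n → ℂ) :
    toeplitzDensity n (fun i => p (i + 1)) x * ((toeplitzDet (n - 1) (shiftedSeries 1 x))⁻¹ *
      (toeplitzDet n (shiftedSeries 0 x) ^ 2 / toeplitzDet (n - 1) (shiftedSeries 1 x)) ^ (1 - p 1)) =
      toeplitzDensity n (reducedExponent p) x := by
  have ha := toeplitzDet_pos (n - 1) (shiftedSeries 1 x)
  have hb := toeplitzDet_pos n (shiftedSeries 0 x)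
  have key : (toeplitzDet (n - 1) (shiftedSeries 1 x))⁻¹ *
      (toeplitzDet n (shiftedSeries 0 x) ^ 2 / toeplitzDet (n - 1) (shiftedSeries 1 x)) ^ (1 - p 1) =
      toeplitzDet n (shiftedSeries 0 x) ^ (-(2 * p 1 - 2)) *
        toeplitzDet (n - 1) (shiftedSeries 1 x) ^ (-(2 - p 1)) := by
    rw [Real.div_rpow (by positivity) ha.le, ← Real.rpow_natCast, ← Real.rpow_mul hb.le,
      ← Real.rpow_neg_one, div_eq_mul_inv, ← Real.rpow_neg ha.le, mul_left_comm,
      ← Real.rpow_add ha]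
    congr 2
    · push_cast
      ring
    · ring
  rw [key]
  -- For `n ≤ 1` there are fewer than two factors to absorb the corrections; the unmatched
  -- determinants have size 0 and equal 1.
  obtain _ | _ | m := n
  · simp [toeplitzDensity, toeplitzDet_zero]
  · simp only [toeplitzDensity, reducedExponent, zero_add, Finset.prod_range_one, Nat.sub_zero,
      Nat.sub_self, toeplitzDet_zero, Real.one_rpow, mul_one, ite_true, OfNat.one_ne_ofNat, ite_false, add_zero]
    rw [← Real.rpow_add hb]
    congr 1
    ring
  · simp only [toeplitzDensity]
    have h3 : ∀ l, reducedExponent p (l + 1 + 1 + 1) = p (l + 1 + 1 + 1 + 1) := fun l => by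
      simp [reducedExponent]
    rw [Finset.prod_range_succ', Finset.prod_range_succ', Finset.prod_range_succ',
      Finset.prod_range_succ']
    simp only [h3]
    simp only [reducedExponent, zero_add, Nat.sub_zero, OfNat.one_ne_ofNat, OfNat.ofNat_ne_one, ite_true,
      ite_false, add_zero, one_add_one_eq_two, Nat.add_sub_cancel] at ha hb ⊢
    rw [neg_add (p 3), neg_add (p 2), Real.rpow_add ha, Real.rpow_add hb]
    ring

/-! ### Integrating out one variable, and the induction -/

theorem lintegral_toeplitzDensity_cons {n : ℕ} (p : ℕ → ℝ) (x : Fin n → ℂ) :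
    ∫⁻ w : ℂ, ENNReal.ofReal (toeplitzDensity (n + 1) p (Fin.cons w x : Fin (n + 1) → ℂ)) =
      if 1 < p 1 then
        ENNReal.ofReal (Real.pi / (p 1 - 1)) *
          ENNReal.ofReal (toeplitzDensity n (reducedExponent p) x)
      else ⊤ := by
  obtain ⟨g, hg⟩ := exists_toeplitzDet_cons x
  have ha := toeplitzDet_pos (n - 1) (shiftedSeries 1 x)
  have hb := div_pos (pow_pos (toeplitzDet_pos n (shiftedSeries 0 x)) 2) ha
  have hd := toeplitzDensity_pos (fun i => p (i + 1)) x
  simp_rw [toeplitzDensity_cons, ENNReal.ofReal_mul hd.le, hg]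
  rw [lintegral_const_mul' _ _ ENNReal.ofReal_ne_top]
  split_ifs with hp
  · rw [lintegral_quadratic_rpow_of_one_lt ha hb hp, ← toeplitzDensity_reducedExponent,
      ← ENNReal.ofReal_mul hd.le,
      ← ENNReal.ofReal_mul (div_nonneg Real.pi_pos.le (sub_nonneg.2 hp.le))]
    congr 1
    ring
  · rw [lintegral_quadratic_rpow_of_le_one ha hb (not_lt.1 hp),
      ENNReal.mul_top (by simpa using hd)]

theorem lintegral_toeplitzDensity_succ (n : ℕ) (p : ℕ → ℝ) :
    ∫⁻ x : Fin (n + 1) → ℂ, ENNReal.ofReal (toeplitzDensity (n + 1) p x) =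
      if 1 < p 1 then
        ENNReal.ofReal (Real.pi / (p 1 - 1)) *
          ∫⁻ x : Fin n → ℂ, ENNReal.ofReal (toeplitzDensity n (reducedExponent p) x)
      else ⊤ := by
  have hm : Measurable fun x => ENNReal.ofReal (toeplitzDensity (n + 1) p x) :=
    (continuous_toeplitzDensity _ _).measurable.ennreal_ofReal
  let e := MeasurableEquiv.piFinSuccAbove (fun _ : Fin (n + 1) => ℂ) 0
  rw [← (volume_preserving_piFinSuccAbove (fun _ : Fin (n + 1) => ℂ) 0).symm.lintegral_comp_emb
    e.symm.measurableEmbedding, Measure.volume_eq_prod]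
  refine (lintegral_prod_symm' _ (hm.comp e.symm.measurable)).trans ?_
  have hcons : ∀ (w : ℂ) (x : Fin n → ℂ), e.symm (w, x) = Fin.cons w x := fun w x => by
    simp [e, MeasurableEquiv.piFinSuccAbove, Fin.insertNthEquiv]
  change ∫⁻ x : Fin n → ℂ, ∫⁻ w : ℂ,
    ENNReal.ofReal (toeplitzDensity (n + 1) p (e.symm (w, x))) = _
  simp_rw [hcons, lintegral_toeplitzDensity_cons]
  split_ifs with hp
  · rw [lintegral_const_mul' _ _ ENNReal.ofReal_ne_top]
  -- The inner integral is infinite for every `x`, and the outer measure is nonzero.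
  · rw [lintegral_const, ENNReal.top_mul (NeZero.ne _)]

theorem forall_weightedSum_succ_iff (n : ℕ) (p : ℕ → ℝ) :
    (∀ k ∈ Finset.Icc 1 (n + 1), 2 * (k : ℝ) - 1 < weightedSum p k) ↔
      1 < p 1 ∧ ∀ k ∈ Finset.Icc 1 n, 2 * (k : ℝ) - 1 < weightedSum (reducedExponent p) k := by
  simp only [Finset.mem_Icc]
  constructor
  · refine fun h => ⟨?_, fun k hk => ?_⟩
    · have := h 1 (by omega)
      rw [weightedSum_one] at this
      norm_num at this
      exact this
    · have := h (k + 1) (by omega)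
      rw [weightedSum_reducedExponent p hk.1]
      push_cast at this
      linarith
  · rintro ⟨h1, h⟩ k hk
    obtain _ | _ | k := k
    · omega
    · rw [zero_add, weightedSum_one]
      norm_num
      exact h1
    · have := h (k + 1) (by omega)
      rw [weightedSum_reducedExponent p (by omega)] at this
      push_cast at this ⊢
      linarith

theorem prod_weightedSum_succ (n : ℕ) (p : ℕ → ℝ) :
    ∏ k ∈ Finset.Icc 1 (n + 1), 1 / (weightedSum p k - (2 * (k : ℝ) - 1)) =
      1 / (p 1 - 1) *
        ∏ k ∈ Finset.Icc 1 n, 1 / (weightedSum (reducedExponent p) k - (2 * (k : ℝ) - 1)) := by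
  rw [Finset.prod_Icc_eq_prod_range, Finset.prod_range_succ',
    Finset.prod_Icc_eq_prod_range, mul_comm, zero_add, weightedSum_one]
  congr 1
  · norm_num
  · refine Finset.prod_congr rfl fun k _ => ?_
    rw [weightedSum_reducedExponent p (by omega)]
    push_cast
    ring

theorem lintegral_toeplitzDensity (n : ℕ) (p : ℕ → ℝ) :
    ∫⁻ x : Fin n → ℂ, ENNReal.ofReal (toeplitzDensity n p x) =
      if ∀ k ∈ Finset.Icc 1 n, 2 * (k : ℝ) - 1 < weightedSum p k then
        ENNReal.ofReal (Real.pi ^ n *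
          ∏ k ∈ Finset.Icc 1 n, 1 / (weightedSum p k - (2 * (k : ℝ) - 1)))
      else ⊤ := by
  induction n generalizing p with
  | zero => simp [toeplitzDensity, volume_pi]
  | succ n ih =>
    rw [lintegral_toeplitzDensity_succ, ih]
    simp only [forall_weightedSum_succ_iff n p]
    by_cases h1 : 1 < p 1
    · have hc : 0 < Real.pi / (p 1 - 1) := div_pos Real.pi_pos (sub_pos.2 h1)
      simp only [h1, if_true, true_and]
      split_ifs with h
      · rw [← ENNReal.ofReal_mul hc.le, prod_weightedSum_succ]
        congr 1
        ring
      · rw [ENNReal.mul_top (by simpa using hc)]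
    · simp [h1]

/-! ### A single determinant, and the theorem -/

theorem weightedSum_single (q : ℝ) {k : ℕ} (hk : 1 ≤ k) :
    weightedSum (fun i => if i = 1 then q else 0) k = k * q := by
  simp [weightedSum, hk]

theorem toeplitzDensity_single {n : ℕ} (hn : 1 ≤ n) (q : ℝ) (x : Fin n → ℂ) :
    toeplitzDensity n (fun i => if i = 1 then q else 0) x =
      1 / toeplitzDet n (shiftedSeries 0 x) ^ q := by
  rw [toeplitzDensity, Finset.prod_eq_single 0]
  · simp [Real.rpow_neg (toeplitzDet_pos n (shiftedSeries 0 x)).le]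
  · intro l _ hl
    simp [hl]
  · intro h
    exact absurd (Finset.mem_range.2 hn) h

/-- The bound `2 - 1 / k` increases with `k`, so only `k = n` matters. -/
theorem forall_mul_gt_iff {n : ℕ} (hn : 1 ≤ n) (q : ℝ) :
    (∀ k ∈ Finset.Icc 1 n, 2 * (k : ℝ) - 1 < k * q) ↔ 2 - 1 / (n : ℝ) < q := by
  have hiff : ∀ k : ℕ, 1 ≤ k → (2 * (k : ℝ) - 1 < k * q ↔ 2 - 1 / (k : ℝ) < q) := fun k hk => by
    have hk' : (0 : ℝ) < k := by exact_mod_cast hk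
    rw [← mul_lt_mul_iff_right₀ hk' (b := 2 - 1 / (k : ℝ)), mul_sub, mul_one_div_cancel hk'.ne', mul_comm 2]
  refine ⟨fun h => (hiff n hn).1 (h n (Finset.mem_Icc.2 ⟨hn, le_rfl⟩)), fun h k hk => ?_⟩
  obtain ⟨hk1, hkn⟩ := Finset.mem_Icc.1 hk
  refine (hiff k hk1).2 (lt_of_le_of_lt ?_ h)
  gcongr

theorem theorem1p1 (n : ℕ) (hn : 1 ≤ n) :
    -- the integral formula, with its exact domain of convergence
    (∀ p : ℕ → ℝ,
      (Integrable (fun x : Fin n → ℂ =>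
          ∏ l ∈ Finset.range n,
            (toeplitzDet (n - l) (shiftedSeries l x)) ^ (-(p (l + 1)))) volume ↔
        ∀ k ∈ Finset.Icc 1 n,
          2 * (k : ℝ) - 1 < ∑ i ∈ Finset.Icc 1 k, ((k : ℝ) - (i : ℝ) + 1) * p i) ∧
      ((∀ k ∈ Finset.Icc 1 n,
          2 * (k : ℝ) - 1 < ∑ i ∈ Finset.Icc 1 k, ((k : ℝ) - (i : ℝ) + 1) * p i) →
        ∫ x : Fin n → ℂ, ∏ l ∈ Finset.range n,
            (toeplitzDet (n - l) (shiftedSeries l x)) ^ (-(p (l + 1))) =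
          Real.pi ^ n * ∏ k ∈ Finset.Icc 1 n,
            1 / ((∑ i ∈ Finset.Icc 1 k, ((k : ℝ) - (i : ℝ) + 1) * p i)
              - (2 * (k : ℝ) - 1)))) ∧
    -- finiteness of the measure with density a power of a single determinant
    (∀ p : ℝ,
      IsFiniteMeasure ((volume : Measure (Fin n → ℂ)).withDensity (fun x =>
          ENNReal.ofReal (1 / (toeplitzDet n (shiftedSeries 0 x)) ^ p))) ↔
        2 - 1 / (n : ℝ) < p) := by
  refine ⟨fun p => ⟨?_, fun h => ?_⟩, fun q => ?_⟩
  · change Integrable (toeplitzDensity n p) volume ↔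
      ∀ k ∈ Finset.Icc 1 n, 2 * (k : ℝ) - 1 < weightedSum p k
    rw [← lintegral_ofReal_ne_top_iff_integrable
      (continuous_toeplitzDensity n p).aestronglyMeasurable
      (.of_forall fun x => (toeplitzDensity_pos p x).le), lintegral_toeplitzDensity]
    split_ifs with h
    · exact iff_of_true ENNReal.ofReal_ne_top h
    · exact iff_of_false (not_not.2 rfl) h
  · change ∀ k ∈ Finset.Icc 1 n, 2 * (k : ℝ) - 1 < weightedSum p k at h
    change ∫ x, toeplitzDensity n p x =
      Real.pi ^ n * ∏ k ∈ Finset.Icc 1 n, 1 / (weightedSum p k - (2 * (k : ℝ) - 1))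
    rw [integral_eq_lintegral_of_nonneg_ae (.of_forall fun x => (toeplitzDensity_pos p x).le)
      (continuous_toeplitzDensity n p).aestronglyMeasurable, lintegral_toeplitzDensity, if_pos h,
      ENNReal.toReal_ofReal]
    exact mul_nonneg (by positivity) (Finset.prod_nonneg fun k hk =>
      one_div_nonneg.2 (sub_nonneg.2 (h k hk).le))
  · have hw : (∀ k ∈ Finset.Icc 1 n,
        2 * (k : ℝ) - 1 < weightedSum (fun i => if i = 1 then q else 0) k) ↔
        2 - 1 / (n : ℝ) < q := by
      rw [← forall_mul_gt_iff hn q]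
      refine forall₂_congr fun k hk => ?_
      rw [weightedSum_single q (Finset.mem_Icc.1 hk).1]
    simp_rw [← toeplitzDensity_single hn q]
    rw [isFiniteMeasure_iff, withDensity_apply _ MeasurableSet.univ, Measure.restrict_univ,
      lintegral_toeplitzDensity, ← hw]
    split_ifs with h
    · exact iff_of_true ENNReal.ofReal_lt_top h
    · exact iff_of_false (lt_irrefl _) h
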